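/- Let $[n]=\{1,\dots,n\}$ and let $\mathcal P(n)$ be the family of all subsets of $[n]$. For a finite simple graph $G$, a family $\mathcal F\subseteq\mathcal P(n)$ contains a Berge-$G$ if there are an injection $\varphi\colon V(G)\to[n]$ and an injection $g\colon E(G)\to\mathcal F$ such that $\{\varphi(u),\varphi(v)\}\subseteq g(uv)$ for every edge $uv\in E(G)$. Let $f(n,G)$ be the smallest number of colors in a coloring of $\mathcal P(n)$ such that no color class contains a Berge-$G$. Let $C_k$, $P_k$, $S_k$ denote the cycle, the path and the star with $k$ edges, respectively. Then, as $n\to\infty$ with $k$ fixed, $$f(n,C_k)=\frac{2^n}{2(k-1)}\,(1+o(1))\quad\text{for every fixed } k\ge 3,$$ $$f(n,P_k)=\frac{2^n}{2(k-1)}\,(1+o(1))\quad\text{and}\quad f(n,S_k)=\frac{2^n}{2(k-1)}\,(1+o(1))\quad\text{for every fixed } k\ge 2.$$ -/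

import Mathlib

open Filter Asymptotics
open scoped Asymptotics

/-- The hypergraph with vertex set `α` and edge set `F` contains a Berge-`G` subhypergraph: the
vertices of `G` can be placed injectively in `α`, and the edges of `G` can be assigned to pairwise
distinct members of `F`, so that each (placed) edge `e` of `G` is a subset of the member of `F`
assigned to it. The members of `F` may contain further vertices. -/
def ContainsBerge {α W : Type*} (F : Set (Finset α)) (G : SimpleGraph W) : Prop :=
  ∃ (φ : W ↪ α) (g : G.edgeSet ↪ Finset α),
    (∀ e, g e ∈ F) ∧ ∀ e : G.edgeSet, ∀ w ∈ (e : Sym2 W), φ w ∈ g e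

/-- A coloring of all subsets of `[n]` in which no color class contains a Berge-`G`. -/
def IsBergeFreeColoring {W : Type*} {n t : ℕ} (c : Finset (Fin n) → Fin t)
    (G : SimpleGraph W) : Prop :=
  ∀ i : Fin t, ¬ ContainsBerge {A | c A = i} G

/-- `bergeNumber n G` is the smallest number of colors in a coloring of all subsets of `[n]`
without a Berge-`G` in any color class. -/
noncomputable def bergeNumber {W : Type*} (n : ℕ) (G : SimpleGraph W) : ℕ :=
  sInf {t : ℕ | ∃ c : Finset (Fin n) → Fin t, IsBergeFreeColoring c G}

/-- If `G` has at least two edges then a coloring without a Berge-`G` in a color class exists,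
so that the infimum in `bergeNumber` is a minimum. -/
theorem bergeNumber_spec {W : Type*} (n : ℕ) (G : SimpleGraph W) (hG : G.edgeSet.Nontrivial) :
    ∃ c : Finset (Fin n) → Fin (bergeNumber n G), IsBergeFreeColoring c G := by
  have h : {t : ℕ | ∃ c : Finset (Fin n) → Fin t, IsBergeFreeColoring c G}.Nonempty := by
    refine ⟨Fintype.card (Finset (Fin n)), Fintype.equivFin _, ?_⟩
    rintro i ⟨φ, g, hg, -⟩
    obtain ⟨x, hx, y, hy, hxy⟩ := hG
    have h1 : _ = i := hg ⟨x, hx⟩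
    have h2 : _ = i := hg ⟨y, hy⟩
    have h3 := g.injective ((Fintype.equivFin _).injective (h1.trans h2.symm))
    exact hxy (congrArg Subtype.val h3)
  exact Nat.sInf_mem h

/-- The cycle with `k` edges (for `k ≥ 3`). -/
abbrev cycleWithEdges (k : ℕ) : SimpleGraph (Fin k) := SimpleGraph.cycleGraph k

/-- The path with `k` edges. -/
abbrev pathWithEdges (k : ℕ) : SimpleGraph (Fin (k + 1)) := SimpleGraph.pathGraph (k + 1)

/-- The star with `k` edges, centered at `0`. -/
abbrev starWithEdges (k : ℕ) : SimpleGraph (Fin (k + 1)) := SimpleGraph.starGraph 0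

/-! Only two properties of the graph matter: it is connected and has `k ≥ 2` edges.

Lower bound: almost all sets have size close to `n / 2` or more (Chebyshev). Among `2k - 1` such
sets the average vertex lies in more than `k - 1`, so linearly many vertices lie in at least `k`,
and by pigeonhole some `k` sets share many vertices and host any graph with `k` edges. Hence a color
class has at most `2(k - 1)` such sets (`card_le_of_not_containsBerge`).

Upper bound: a class made of `k - 1` sets and `k - 1` sets disjoint from them is safe, since a
connected copy stays on one side (`not_containsBerge_union`). Long chains together with their
complements split into such classes with little waste (`bergeFreeCover_chain`). By Sperner's
theorem, greedily removing chains from the sets avoiding a fixed point leaves only `o(2 ^ n)` of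
them. -/

namespace BergeColoring

open Finset

/-! ### Binomial estimates and concentration of set sizes -/

section Counting

/-- The central binomial coefficient is `O(4 ^ m / √m)`. -/
theorem centralBinom_sq_mul_le (m : ℕ) : m.centralBinom ^ 2 * (2 * m + 1) ≤ 16 ^ m := by
  induction m with
  | zero => simp
  | succ m ih =>
    have h := Nat.succ_mul_centralBinom_succ m
    have h2 : (m + 1) ^ 2 * ((m + 1).centralBinom ^ 2 * (2 * (m + 1) + 1)) ≤
        (m + 1) ^ 2 * 16 ^ (m + 1) := by
      calc (m + 1) ^ 2 * ((m + 1).centralBinom ^ 2 * (2 * (m + 1) + 1))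
          = ((m + 1) * (m + 1).centralBinom) ^ 2 * (2 * m + 3) := by ring
        _ = (m.centralBinom ^ 2 * (2 * m + 1)) * (4 * ((2 * m + 1) * (2 * m + 3))) := by
          rw [h]; ring
        _ ≤ 16 ^ m * (4 * (4 * (m + 1) ^ 2)) := by
          refine Nat.mul_le_mul ih (Nat.mul_le_mul_left _ ?_)
          nlinarith
        _ = (m + 1) ^ 2 * 16 ^ (m + 1) := by ring
    exact Nat.le_of_mul_le_mul_left h2 (by positivity)

theorem choose_half_sq_mul_le (n : ℕ) : (n.choose (n / 2)) ^ 2 * n ≤ 4 ^ n := by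
  obtain ⟨m, rfl | rfl⟩ := n.even_or_odd'
  · have h := centralBinom_sq_mul_le m
    rw [Nat.centralBinom_eq_two_mul_choose] at h
    rw [Nat.mul_div_cancel_left _ two_pos, pow_mul]
    norm_num
    nlinarith
  · have h := centralBinom_sq_mul_le (m + 1)
    -- For odd `n` the middle coefficient is half of the next central one.
    have h1 : (m + 1).centralBinom = 2 * (2 * m + 1).choose m := by
      rw [Nat.centralBinom_eq_two_mul_choose, show 2 * (m + 1) = 2 * m + 1 + 1 by ring,
        Nat.choose_succ_succ, Nat.succ_eq_add_one, Nat.choose_symm_half, ← two_mul]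
    rw [h1] at h
    rw [show (2 * m + 1) / 2 = m by omega, pow_succ 4, pow_mul]
    rw [pow_succ 16] at h
    norm_num at h ⊢
    nlinarith [Nat.zero_le (((2 * m + 1).choose m) ^ 2)]

theorem tendsto_choose_half_div_two_pow :
    Tendsto (fun n : ℕ => ((n.choose (n / 2) : ℕ) : ℝ) / 2 ^ n) atTop (nhds 0) := by
  have h : Tendsto (fun n : ℕ => √(1 / (n : ℝ))) atTop (nhds 0) := by
    have := (Real.continuous_sqrt.tendsto 0).comp
      (tendsto_one_div_atTop_nhds_zero_nat (𝕜 := ℝ))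
    simpa [Function.comp_def] using this
  refine squeeze_zero' (Eventually.of_forall fun n => by positivity) ?_ h
  filter_upwards [eventually_gt_atTop 0] with n hn
  apply Real.le_sqrt_of_sq_le
  have h1 : (((n.choose (n / 2)) ^ 2 * n : ℕ) : ℝ) ≤ ((4 ^ n : ℕ) : ℝ) :=
    Nat.cast_le.2 (choose_half_sq_mul_le n)
  have hn' : (0 : ℝ) < n := Nat.cast_pos.2 hn
  rw [div_pow, ← pow_mul, mul_comm n 2, pow_mul, div_le_div_iff₀ (by positivity) hn']
  push_cast at h1
  norm_num
  linarith

/-- This is the variance of the binomial distribution at `1 / 2`, rescaled by `4 * 2 ^ n`. -/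
theorem sum_two_mul_card_sub_sq (n : ℕ) :
    ∑ A : Finset (Fin n), (2 * (#A : ℝ) - n) ^ 2 = (n : ℝ) * 2 ^ n := by
  have h := congrArg (Polynomial.eval (1 / 2 : ℝ)) (bernsteinPolynomial.variance ℝ n)
  rw [← Finset.powerset_univ,
    Finset.sum_powerset_apply_card (fun m : ℕ => (2 * (m : ℝ) - n) ^ 2)]
  simp only [bernsteinPolynomial, Polynomial.eval_finsetSum, nsmul_eq_mul, Polynomial.eval_mul,
    Polynomial.eval_pow, Polynomial.eval_sub, Polynomial.eval_natCast, Polynomial.eval_X,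
    Polynomial.eval_one] at h
  have h3 : ∀ m ∈ range (n + 1), ((n : ℝ) * (1 / 2) - m) ^ 2 *
      ((n.choose m : ℝ) * (1 / 2) ^ m * (1 - 1 / 2) ^ (n - m)) * (4 * 2 ^ n) =
      n.choose m • ((2 * (m : ℝ) - n) ^ 2) := by
    intro m hm
    have hm' : m ≤ n := Nat.lt_succ_iff.1 (mem_range.1 hm)
    have : ((1 : ℝ) / 2) ^ m * (1 - 1 / 2) ^ (n - m) * 2 ^ n = 1 := by
      rw [show (1 : ℝ) - 1 / 2 = 1 / 2 by norm_num, ← pow_add, Nat.add_sub_cancel' hm',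
        ← mul_pow]
      norm_num
    rw [nsmul_eq_mul]
    linear_combination (4 * ((n : ℝ) * (1 / 2) - m) ^ 2 * (n.choose m : ℝ)) * this
  rw [card_univ, Fintype.card_fin, ← sum_congr rfl h3, ← sum_mul, h]
  ring

/-- Chebyshev's inequality: few subsets of `Fin n` have fewer than `(1 - 1 / r) * n / 2`
elements. -/
theorem card_small_le (n r : ℕ) (hr : 0 < r) (hn : 0 < n) :
    (#{A : Finset (Fin n) | 2 * r * #A < (r - 1) * n} : ℝ) ≤ r ^ 2 / n * 2 ^ n := by
  have hn' : (0 : ℝ) < n := Nat.cast_pos.2 hn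
  have hr' : (0 : ℝ) < r := Nat.cast_pos.2 hr
  have h1 : (#{A : Finset (Fin n) | 2 * r * #A < (r - 1) * n} : ℝ) * ((n : ℝ) / r) ^ 2 ≤
      (n : ℝ) * 2 ^ n := by
    rw [← sum_two_mul_card_sub_sq n, ← nsmul_eq_mul]
    refine (card_nsmul_le_sum _ (fun A : Finset (Fin n) => (2 * (#A : ℝ) - n) ^ 2) _ ?_).trans
      (sum_le_sum_of_subset_of_nonneg (subset_univ _) fun _ _ _ => sq_nonneg _)
    intro A hA
    have hA : 2 * r * #A < (r - 1) * n := (mem_filter.1 hA).2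
    have hA' : (2 * r * #A : ℝ) < (r - 1) * n := by
      have := (Nat.cast_lt (α := ℝ)).2 hA
      rw [Nat.cast_mul, Nat.cast_mul (r - 1), Nat.cast_pred hr] at this
      exact_mod_cast this
    have h2 : (n : ℝ) / r ≤ n - 2 * #A := by
      rw [div_le_iff₀ hr']
      nlinarith
    calc ((n : ℝ) / r) ^ 2 ≤ (n - 2 * #A) ^ 2 := by gcongr
      _ = _ := by ring
  have h2 : ((n : ℝ) / r) ^ 2 * (r ^ 2 / n * 2 ^ n) = n * 2 ^ n := by
    field_simp
  rw [← h2, mul_comm] at h1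
  exact le_of_mul_le_mul_left h1 (by positivity)

end Counting

/-! ### Lower bound: large sets with a large common intersection -/

section LowerBound

variable {α W : Type*} [Fintype α] [DecidableEq α]

/-- A family of at least `k` sets with a large common intersection contains every small graph with
at most `k` edges. -/
theorem containsBerge_of_common {α W : Type*} [Fintype W] {G : SimpleGraph W} {F : Finset (Finset α)}
    {S : Finset α} (hS : ∀ v ∈ S, ∀ A ∈ F, v ∈ A) (hF : Nat.card G.edgeSet ≤ #F)
    (hW : Fintype.card W ≤ #S) : ContainsBerge (F : Set (Finset α)) G := by
  classical
  obtain ⟨φ⟩ : Nonempty (W ↪ S) :=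
    Function.Embedding.nonempty_of_card_le (by simpa using hW)
  obtain ⟨g⟩ : Nonempty (G.edgeSet ↪ F) :=
    Function.Embedding.nonempty_of_card_le (by
      rw [Fintype.card_coe, ← Nat.card_eq_fintype_card]; exact hF)
  exact ⟨φ.trans (Function.Embedding.subtype _), g.trans (Function.Embedding.subtype _),
    fun e => (g e).2, fun e w _ => hS _ (φ w).2 _ (g e).2⟩

/-- Among `2 * k - 1` sets of size about half of the ground set, some `k` sets have an intersection
of linear size. -/
theorem exists_common (k : ℕ) (hk : 1 ≤ k) (F : Finset (Finset α)) (hF : #F = 2 * k - 1)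
    (hA : ∀ A ∈ F, (4 * k - 3) * Fintype.card α ≤ 2 * (4 * k - 2) * #A) (m : ℕ)
    (hm : 4 * k * 2 ^ (2 * k - 1) * m ≤ Fintype.card α) :
    ∃ F' ⊆ F, k ≤ #F' ∧ ∃ S : Finset α, m ≤ #S ∧ ∀ v ∈ S, ∀ A ∈ F', v ∈ A := by
  classical
  obtain ⟨j, rfl⟩ : ∃ j, k = j + 1 := ⟨k - 1, by omega⟩
  set n := Fintype.card α
  let T : Finset α := univ.filter fun v => j + 1 ≤ #{A ∈ F | v ∈ A}
  have hsum : ∑ A ∈ F, #A = ∑ v : α, #{A ∈ F | v ∈ A} := by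
    have := sum_card_bipartiteAbove_eq_sum_card_bipartiteBelow (s := F) (t := univ)
      (fun (A : Finset α) v => v ∈ A)
    simpa [bipartiteAbove, bipartiteBelow] using this
  -- A vertex outside `T` lies in at most `j` sets, any other in at most all `2 * j + 1`.
  have hup : ∑ v : α, #{A ∈ F | v ∈ A} ≤ j * n + (j + 1) * #T := by
    calc ∑ v : α, #{A ∈ F | v ∈ A}
        ≤ ∑ v : α, (j + if v ∈ T then j + 1 else 0) := by
          refine sum_le_sum fun v _ => ?_
          have : #{A ∈ F | v ∈ A} ≤ #F := card_filter_le _ _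
          by_cases hv : v ∈ T
          · simp only [hv, if_true]; omega
          · simp only [hv, if_false]
            simp only [T, mem_filter, mem_univ, true_and] at hv
            omega
      _ = j * n + (j + 1) * #T := by
          simp [sum_add_distrib, n, mul_comm]
  -- The average degree is at least `j + 1 / 4`; the surplus `1 / 4` over `j` forces `T` to be
  -- large.
  have hlow : (4 * j + 1) * n ≤ 4 * ∑ A ∈ F, #A := by
    have h1 : #F • ((4 * j + 1) * n) ≤ ∑ A ∈ F, (2 * (4 * j + 2) * #A) :=
      card_nsmul_le_sum _ _ _ fun A hAF => by
        have := hA A hAF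
        rwa [show 4 * (j + 1) - 3 = 4 * j + 1 by omega,
          show 4 * (j + 1) - 2 = 4 * j + 2 by omega] at this
    rw [← mul_sum, hF, show 2 * (j + 1) - 1 = 2 * j + 1 by omega, smul_eq_mul] at h1
    have h2 : (2 * j + 1) * ((4 * j + 1) * n) ≤ (2 * j + 1) * (4 * ∑ A ∈ F, #A) := by
      linarith
    exact Nat.le_of_mul_le_mul_left h2 (by omega)
  have hT : n ≤ 4 * (j + 1) * #T := by
    rw [hsum] at hlow
    linarith
  have hTm : #F.powerset * m ≤ #T := by
    rw [card_powerset, hF]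
    have : 4 * (j + 1) * (2 ^ (2 * (j + 1) - 1) * m) ≤ 4 * (j + 1) * #T := by
      rw [← mul_assoc]; exact hm.trans hT
    exact Nat.le_of_mul_le_mul_left this (by omega)
  by_cases hne : T.Nonempty
  -- Pigeonhole on the subfamily of `F` formed by the sets through `v`.
  · obtain ⟨F', hF', hcard⟩ := exists_le_card_fiber_of_mul_le_card_of_maps_to
      (f := fun v => F.filter (v ∈ ·)) (s := T) (t := F.powerset) (n := m)
      (fun v _ => mem_powerset.2 (filter_subset _ _)) ⟨∅, empty_mem_powerset _⟩ hTm
    -- For `m = 0` the chosen fiber may be empty and say nothing about `#F'`.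
    rcases Nat.eq_zero_or_pos m with rfl | hm0
    · exact ⟨F, Subset.rfl, by omega, ∅, by simp, by simp⟩
    · obtain ⟨v, hv⟩ := card_pos.1 (hm0.trans_le hcard)
      refine ⟨F', mem_powerset.1 hF', ?_, _, hcard, ?_⟩
      · rw [← (mem_filter.1 hv).2]
        exact (mem_filter.1 (mem_filter.1 hv).1).2
      · intro v hv A hA
        rw [← (mem_filter.1 hv).2] at hA
        exact (mem_filter.1 hA).2
  · rw [not_nonempty_iff_eq_empty.1 hne, card_empty, Nat.le_zero, card_powerset, hF] at hTm
    have : m = 0 := by simpa using hTm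
    exact ⟨F, Subset.rfl, by omega, ∅, by simp [this], by simp⟩

theorem _root_.ContainsBerge.mono {α W : Type*} {G : SimpleGraph W} {F F' : Set (Finset α)} (h : F ⊆ F')
    (hF : ContainsBerge F G) : ContainsBerge F' G := by
  obtain ⟨φ, g, hg, hφ⟩ := hF
  exact ⟨φ, g, fun e => h (hg e), hφ⟩

/-- A Berge-free family has at most `2 * (k - 1)` members of size about half of the ground set. -/
theorem card_le_of_not_containsBerge [Fintype W] {G : SimpleGraph W} {k : ℕ} (hk : 1 ≤ k)
    (hG : Nat.card G.edgeSet ≤ k)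
    (hn : 4 * k * 2 ^ (2 * k - 1) * Fintype.card W ≤ Fintype.card α) {F : Finset (Finset α)}
    (hA : ∀ A ∈ F, (4 * k - 3) * Fintype.card α ≤ 2 * (4 * k - 2) * #A)
    (hF : ¬ ContainsBerge (F : Set (Finset α)) G) : #F ≤ 2 * (k - 1) := by
  by_contra! h
  obtain ⟨F₁, hF₁, hc⟩ := exists_subset_card_eq (show 2 * k - 1 ≤ #F by omega)
  obtain ⟨F', hF', hk', S, hS, hSF⟩ :=
    exists_common k hk F₁ hc (fun A h => hA A (hF₁ h)) _ hn
  exact hF ((containsBerge_of_common hSF (hG.trans hk') hS).mono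
    (coe_subset.2 (hF'.trans hF₁)))

theorem two_pow_le_bergeNumber [Fintype W] {G : SimpleGraph W} {k : ℕ} (hk : 2 ≤ k)
    (hG : Nat.card G.edgeSet = k) {n : ℕ} (hn0 : 0 < n)
    (hn : 4 * k * 2 ^ (2 * k - 1) * Fintype.card W ≤ n) :
    (2 : ℝ) ^ n * (1 - ((4 * k - 2 : ℕ) : ℝ) ^ 2 / n) ≤ bergeNumber n G * (2 * ((k : ℝ) - 1)) := by
  classical
  obtain ⟨c, hc⟩ := bergeNumber_spec n G (by
    rw [← Set.one_lt_ncard_iff_nontrivial, ← Nat.card_coe_set_eq]; omega)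
  -- Chebyshev is used with `r = 4 * k - 2`, the tolerance required by `exists_common`.
  let B : Finset (Finset (Fin n)) := {A | ¬ 2 * (4 * k - 2) * #A < (4 * k - 2 - 1) * n}
  have hB : (2 : ℝ) ^ n - ((4 * k - 2 : ℕ) : ℝ) ^ 2 / n * 2 ^ n ≤ #B := by
    have h1 := card_small_le n (4 * k - 2) (by omega) hn0
    have h2 := card_filter_add_card_filter_not (s := (univ : Finset (Finset (Fin n))))
      (fun A => 2 * (4 * k - 2) * #A < (4 * k - 2 - 1) * n)
    rw [card_univ, Fintype.card_finset, Fintype.card_fin] at h2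
    have h3 := congrArg (Nat.cast (R := ℝ)) h2
    push_cast at h3
    linarith
  have hB' : #B ≤ 2 * (k - 1) * #(univ : Finset (Fin (bergeNumber n G))) := by
    refine card_le_mul_card_image_of_maps_to (f := c) (fun A _ => mem_univ _) _ fun i _ => ?_
    refine card_le_of_not_containsBerge (G := G) (by omega) hG.le (by simpa using hn) ?_ ?_
    · intro A hA
      have h := not_lt.1 (mem_filter.1 (mem_filter.1 hA).1).2
      rwa [Fintype.card_fin, show 4 * k - 3 = 4 * k - 2 - 1 by omega]
    · intro h
      refine hc i (h.mono ?_)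
      intro A hA
      exact (mem_filter.1 hA).2
  rw [card_univ, Fintype.card_fin] at hB'
  have h4 := (Nat.cast_le (α := ℝ)).2 hB'
  push_cast [Nat.cast_pred (show 0 < k by omega)] at h4
  linarith

end LowerBound

/-! ### Upper bound: chains and their complements -/

section UpperBound

variable {α W : Type*} [Fintype α] [DecidableEq α]

/-- A connected graph with at least `k` edges has no Berge copy in the union of two families of
fewer than `k` sets if each set of the first family is disjoint from each set of the second. -/
theorem not_containsBerge_union {G : SimpleGraph W} (hG : G.Connected) [Finite W] {k : ℕ}
    (hk : k ≤ Nat.card G.edgeSet) {D U : Finset (Finset α)} (hD : #D < k) (hU : #U < k)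
    (hDU : ∀ A ∈ D, ∀ B ∈ U, Disjoint A B) :
    ¬ ContainsBerge ((D ∪ U : Finset (Finset α)) : Set (Finset α)) G := by
  rintro ⟨φ, g, hg, hφ⟩
  classical
  have := Fintype.ofFinite W
  have key : ∀ E : Finset (Finset α), #E < k → ¬ ∀ e, g e ∈ E := by
    intro E hE h
    have h1 := Nat.card_le_card_of_injective (fun e => (⟨g e, h e⟩ : E))
      (fun a b hab => g.injective (congrArg Subtype.val hab))
    rw [Nat.card_eq_fintype_card (α := E), Fintype.card_coe] at h1
    omega
  -- A set containing both ends of an edge is in `D` or misses the union of `D`, so lying in that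
  -- union is constant along edges.
  have hadj : ∀ u v, G.Adj u v → (φ u ∈ D.sup id ↔ φ v ∈ D.sup id) := by
    intro u v huv
    have hu := hφ ⟨s(u, v), huv⟩ u (by simp)
    have hv := hφ ⟨s(u, v), huv⟩ v (by simp)
    simp only [Finset.mem_sup, id]
    rcases mem_union.1 (mem_coe.1 (hg ⟨s(u, v), huv⟩)) with h | h
    · exact ⟨fun _ => ⟨_, h, hv⟩, fun _ => ⟨_, h, hu⟩⟩
    · constructor
      · rintro ⟨A, hA, huA⟩
        exact absurd hu (disjoint_left.1 (hDU A hA _ h) huA)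
      · rintro ⟨A, hA, huA⟩
        exact absurd hv (disjoint_left.1 (hDU A hA _ h) huA)
  have hconst : ∀ u v, φ u ∈ D.sup id ↔ φ v ∈ D.sup id := by
    intro u v
    obtain ⟨p⟩ := hG.preconnected u v
    induction p with
    | nil => rfl
    | cons h _ ih => exact (hadj _ _ h).trans ih
  obtain ⟨w⟩ := hG.nonempty
  by_cases hw : φ w ∈ D.sup id
  · refine key D hD fun e => ?_
    obtain ⟨e, he⟩ := e
    induction e using Sym2.ind with
    | _ u v =>
    have hu := hφ ⟨s(u, v), he⟩ u (by simp)
    refine (mem_union.1 (mem_coe.1 (hg ⟨s(u, v), he⟩))).resolve_right fun h => ?_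
    obtain ⟨A, hA, huA⟩ := Finset.mem_sup.1 ((hconst w u).1 hw)
    exact disjoint_left.1 (hDU A hA _ h) huA hu
  · refine key U hU fun e => ?_
    obtain ⟨e, he⟩ := e
    induction e using Sym2.ind with
    | _ u v =>
    have hu := hφ ⟨s(u, v), he⟩ u (by simp)
    refine (mem_union.1 (mem_coe.1 (hg ⟨s(u, v), he⟩))).resolve_left fun h => ?_
    exact hw ((hconst w u).2 (Finset.mem_sup.2 ⟨_, h, hu⟩))

/-- The family `S` can be covered by `t` families without a Berge-`G`. -/
def BergeFreeCover {α W : Type*} (G : SimpleGraph W) (S : Finset (Finset α)) (t : ℕ) : Prop :=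
  ∃ K : Finset (Finset (Finset α)), #K ≤ t ∧ (∀ A ∈ S, ∃ C ∈ K, A ∈ C) ∧
    ∀ C ∈ K, ¬ ContainsBerge (C : Set (Finset α)) G

theorem BergeFreeCover.union {α W : Type*} [DecidableEq α] {G : SimpleGraph W} {S T : Finset (Finset α)} {s t : ℕ}
    (hS : BergeFreeCover G S s) (hT : BergeFreeCover G T t) :
    BergeFreeCover G (S ∪ T) (s + t) := by
  obtain ⟨K, hK, hSK, hKG⟩ := hS
  obtain ⟨L, hL, hTL, hLG⟩ := hT
  refine ⟨K ∪ L, (card_union_le _ _).trans (add_le_add hK hL), ?_, ?_⟩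
  · intro A hA
    rcases mem_union.1 hA with h | h
    · obtain ⟨C, hC, hAC⟩ := hSK A h
      exact ⟨C, mem_union_left _ hC, hAC⟩
    · obtain ⟨C, hC, hAC⟩ := hTL A h
      exact ⟨C, mem_union_right _ hC, hAC⟩
  · intro C hC
    exact (mem_union.1 hC).elim (hKG C) (hLG C)

theorem BergeFreeCover.mono {α W : Type*} {G : SimpleGraph W} {S T : Finset (Finset α)} {s t : ℕ}
    (h : BergeFreeCover G S s) (hT : T ⊆ S) (hst : s ≤ t) : BergeFreeCover G T t := by
  obtain ⟨K, hK, hSK, hKG⟩ := h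
  exact ⟨K, hK.trans hst, fun A hA => hSK A (hT hA), hKG⟩

theorem bergeNumber_le_of_cover {G : SimpleGraph W} {n t : ℕ}
    (h : BergeFreeCover G (univ : Finset (Finset (Fin n))) t) : bergeNumber n G ≤ t := by
  obtain ⟨K, hK, hSK, hKG⟩ := h
  refine le_trans (Nat.sInf_le ?_) hK
  choose C hC hAC using fun A => hSK A (mem_univ A)
  refine ⟨fun A => K.equivFin ⟨C A, hC A⟩, fun i hi => hKG _ (K.equivFin.symm i).2 (hi.mono ?_)⟩
  rintro A rfl
  simpa using hAC A

/-- A family larger than `l` times the middle binomial coefficient contains a chain of `l + 1`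
sets. -/
theorem exists_strictMono_of_card_lt (l : ℕ) (R : Finset (Finset α))
    (hR : l * (Fintype.card α).choose (Fintype.card α / 2) < #R) :
    ∃ E : Fin (l + 1) → Finset α, StrictMono E ∧ ∀ i, E i ∈ R := by
  induction l generalizing R with
  | zero =>
    obtain ⟨A, hA⟩ := card_pos.1 (by simpa using hR)
    exact ⟨fun _ => A, Subsingleton.strictMono (α := Fin 1) _, fun _ => hA⟩
  | succ l ih =>
    -- The minimal members form an antichain; a chain in the rest extends downwards by one set.
    let M := R.filter fun A => ∀ B ∈ R, ¬ B ⊂ A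
    have hM : #M ≤ (Fintype.card α).choose (Fintype.card α / 2) := by
      refine IsAntichain.sperner fun A hA B hB hne hAB => ?_
      exact (mem_filter.1 hB).2 A (mem_filter.1 hA).1 (hAB.ssubset_of_ne hne)
    have hM' := card_sdiff_add_card_eq_card (filter_subset (fun A => ∀ B ∈ R, ¬ B ⊂ A) R)
    obtain ⟨E, hE, hER⟩ := ih (R \ M) (by
      rw [add_mul, one_mul] at hR
      change #(R \ M) + #M = #R at hM'
      omega)
    have h0 := mem_sdiff.1 (hER 0)
    have h1 : ∃ B ∈ R, B ⊂ E 0 := by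
      by_contra! h
      exact h0.2 (mem_filter.2 ⟨h0.1, h⟩)
    obtain ⟨B, hB, hBE⟩ := h1
    refine ⟨Fin.cons B E, ?_, ?_⟩
    · rw [Fin.strictMono_iff_lt_succ]
      intro i
      induction i using Fin.cases with
      | zero => simpa using hBE
      | succ i =>
        rw [← Fin.succ_castSucc, Fin.cons_succ, Fin.cons_succ]
        exact hE i.castSucc_lt_succ
    · intro i
      induction i using Fin.cases with
      | zero => simpa using hB
      | succ i => simpa using (mem_sdiff.1 (hER i)).1

theorem card_block_le (p l j : ℕ) (hp : 0 < p) : #{i : Fin l | (i : ℕ) / p = j} ≤ p := by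
  calc #{i : Fin l | (i : ℕ) / p = j} ≤ #(Ico (j * p) (j * p + p)) := by
        refine card_le_card_of_injOn (fun i => (i : ℕ)) ?_ (fun a _ b _ h => Fin.ext h)
        intro i hi
        have hi : (i : ℕ) / p = j := by simpa using hi
        have := (Nat.div_eq_iff hp).1 hi
        simp only [coe_Ico, Set.mem_Ico]
        omega
    _ = p := by simp

/-- A chain of `N * p` sets together with the complements of its members can be covered by
`N + 1` families without a Berge-`G`, if `G` is connected and has more than `p` edges. -/
theorem bergeFreeCover_chain {G : SimpleGraph W} (hG : G.Connected) [Finite W] {p : ℕ}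
    (hp : 0 < p) (hk : p + 1 ≤ Nat.card G.edgeSet) (N : ℕ) {l : ℕ} (hl : l ≤ N * p)
    {E : Fin l → Finset α} (hE : StrictMono E) :
    BergeFreeCover G (univ.image E ∪ (univ.image E).image compl) (N + 1) := by
  -- Block `j - 1` of the chain is matched with the complements of block `j`, so that every set of
  -- the former lies inside every set of the latter. The shift costs the one extra family.
  let D : ℕ → Finset (Finset α) := fun j =>
    (univ.filter fun i : Fin l => (i : ℕ) / p + 1 = j).image E
  let U : ℕ → Finset (Finset α) := fun j =>
    (univ.filter fun i : Fin l => (i : ℕ) / p = j).image fun i => (E i)ᶜ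
  have hlt : ∀ i : Fin l, (i : ℕ) / p < N := fun i =>
    Nat.div_lt_of_lt_mul (by rw [mul_comm]; exact i.2.trans_le hl)
  refine ⟨(range (N + 1)).image fun j => D j ∪ U j, card_image_le.trans (by simp), ?_, ?_⟩
  · intro A hA
    rcases mem_union.1 hA with h | h
    · obtain ⟨i, -, rfl⟩ := mem_image.1 h
      refine ⟨_, mem_image_of_mem _ (mem_range.2 (Nat.succ_lt_succ (hlt i))), mem_union_left _ ?_⟩
      exact mem_image_of_mem _ (by simp)
    · obtain ⟨B, hB, rfl⟩ := mem_image.1 h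
      obtain ⟨i, -, rfl⟩ := mem_image.1 hB
      refine ⟨_, mem_image_of_mem _ (mem_range.2 ((hlt i).trans N.lt_succ_self)),
        mem_union_right _ ?_⟩
      exact mem_image_of_mem (fun i => (E i)ᶜ) (by simp)
  · intro C hC
    obtain ⟨j, -, rfl⟩ := mem_image.1 hC
    refine not_containsBerge_union hG hk (Nat.lt_succ_of_le ?_) (Nat.lt_succ_of_le ?_) ?_
    · refine card_image_le.trans ((card_le_card ?_).trans (card_block_le p l (j - 1) hp))
      intro i hi
      simp only [mem_filter, mem_univ, true_and] at hi ⊢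
      exact Nat.eq_sub_of_add_eq hi
    · exact card_image_le.trans (card_block_le p l j hp)
    · intro A hA B hB
      obtain ⟨a, ha, rfl⟩ := mem_image.1 hA
      obtain ⟨b, hb, rfl⟩ := mem_image.1 hB
      simp only [mem_filter, mem_univ, true_and] at ha hb
      have hab : a ≤ b := by
        by_contra! h
        have := Nat.div_le_div_right (c := p) (Fin.le_def.1 h.le)
        linarith
      exact disjoint_compl_right.mono_left (hE.monotone hab)

theorem bergeFreeCover_singletons {G : SimpleGraph W} (hG : G.Connected) [Finite W]
    (hk : 2 ≤ Nat.card G.edgeSet) (S : Finset (Finset α)) : BergeFreeCover G S (#S) := by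
  refine ⟨S.image singleton, card_image_le, fun A hA =>
    ⟨_, mem_image_of_mem _ hA, mem_singleton_self A⟩, ?_⟩
  intro C hC
  obtain ⟨A, -, rfl⟩ := mem_image.1 hC
  simpa using not_containsBerge_union hG hk (D := {A}) (U := ∅) (by simp) (by simp) (by simp)

/-- A greedy decomposition into long chains covers any family together with all complements. -/
theorem exists_bergeFreeCover_compl {G : SimpleGraph W} (hG : G.Connected) [Finite W] {p : ℕ}
    (hp : 0 < p) (hk : p + 1 ≤ Nat.card G.edgeSet) {N : ℕ} (hN : 0 < N)
    (R : Finset (Finset α)) :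
    ∃ t, BergeFreeCover G (R ∪ R.image compl) t ∧ t * (N * p) ≤ (N + 1) * #R +
      N * p * (2 * (N * p) * (Fintype.card α).choose (Fintype.card α / 2)) := by
  induction R using Finset.strongInduction with
  | H R ih =>
  have hNp : 0 < N * p := by positivity
  -- A small remainder is covered by singletons; otherwise there is a chain of `N * p` sets to
  -- remove.
  rcases le_or_gt #R (N * p * (Fintype.card α).choose (Fintype.card α / 2)) with h | h
  · refine ⟨_, bergeFreeCover_singletons hG (by omega) _, ?_⟩
    have h1 : #(R ∪ R.image compl) ≤
        2 * (N * p) * (Fintype.card α).choose (Fintype.card α / 2) := by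
      have h2 := card_union_le R (R.image compl)
      have h3 : #(R.image compl) ≤ #R := card_image_le
      linarith
    calc _ ≤ 2 * (N * p) * (Fintype.card α).choose (Fintype.card α / 2) * (N * p) := by gcongr
      _ ≤ _ := by rw [mul_comm]; exact Nat.le_add_left _ _
  · obtain ⟨E, hE, hER⟩ := exists_strictMono_of_card_lt (N * p - 1) R
      (lt_of_le_of_lt (Nat.mul_le_mul_right _ (Nat.sub_le _ _)) h)
    set X := univ.image E
    have hXR : X ⊆ R := by
      intro A hA
      obtain ⟨i, -, rfl⟩ := mem_image.1 hA
      exact hER i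
    have hX : #X = N * p := by
      rw [card_image_of_injective _ hE.injective, card_univ, Fintype.card_fin]
      omega
    obtain ⟨t, ht, htc⟩ := ih (R \ X) (sdiff_ssubset hXR (card_pos.1 (by omega)))
    refine ⟨t + (N + 1),
      (ht.union (bergeFreeCover_chain hG hp hk N (by omega) hE)).mono ?_ le_rfl, ?_⟩
    · intro A hA
      rw [mem_union, mem_union, mem_union]
      rcases mem_union.1 hA with hA | hA
      · by_cases hAX : A ∈ X
        · exact Or.inr (Or.inl hAX)
        · exact Or.inl (Or.inl (mem_sdiff.2 ⟨hA, hAX⟩))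
      · obtain ⟨B, hB, rfl⟩ := mem_image.1 hA
        by_cases hBX : B ∈ X
        · exact Or.inr (Or.inr (mem_image_of_mem _ hBX))
        · exact Or.inl (Or.inr (mem_image_of_mem _ (mem_sdiff.2 ⟨hB, hBX⟩)))
    · have h3 := card_sdiff_add_card_eq_card hXR
      rw [← h3, hX]
      linarith

/-- The sets avoiding a fixed point are half of all sets, and their complements are the other half.
-/
theorem bergeNumber_mul_le {G : SimpleGraph W} (hG : G.Connected) [Finite W] {p : ℕ}
    (hp : 0 < p) (hk : p + 1 ≤ Nat.card G.edgeSet) {N : ℕ} (hN : 0 < N) {n : ℕ} (hn : 0 < n) :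
    2 * (bergeNumber n G * (N * p)) ≤
      (N + 1) * 2 ^ n + 2 * (N * p * (2 * (N * p) * n.choose (n / 2))) := by
  let x : Fin n := ⟨0, hn⟩
  let R : Finset (Finset (Fin n)) := {A | x ∉ A}
  obtain ⟨t, ht, htc⟩ := exists_bergeFreeCover_compl hG hp hk hN R
  have hcov : R ∪ R.image compl = univ := by
    ext A
    simp only [mem_union, mem_image, mem_univ, iff_true, R, mem_filter, true_and]
    by_cases hA : x ∈ A
    · exact Or.inr ⟨Aᶜ, by simpa using hA, compl_compl A⟩
    · exact Or.inl hA
  have hR : 2 * #R = 2 ^ n := by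
    have h1 : Disjoint R (R.image compl) := by
      rw [disjoint_left]
      intro A hA hA'
      obtain ⟨B, hB, rfl⟩ := mem_image.1 hA'
      simp only [R, mem_filter, mem_univ, true_and, mem_compl, not_not] at hA hB
      exact hB hA
    have h2 := card_union_of_disjoint h1
    rw [hcov, card_image_of_injective _ compl_injective, card_univ, Fintype.card_finset,
      Fintype.card_fin] at h2
    omega
  rw [hcov] at ht
  rw [Fintype.card_fin] at htc
  have := Nat.mul_le_mul_right (N * p) (bergeNumber_le_of_cover ht)
  rw [← hR]
  linarith

end UpperBound

/-- For a connected graph `G` with `k ≥ 2` edges, `bergeNumber n G` is asymptotically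
`2 ^ n / (2 * (k - 1))`. -/
theorem bergeNumber_isEquivalent {W : Type*} [Fintype W] {G : SimpleGraph W} (hG : G.Connected)
    {k : ℕ} (hk : 2 ≤ k) (hGk : Nat.card G.edgeSet = k) :
    (fun n : ℕ => (bergeNumber n G : ℝ)) ~[atTop]
      fun n : ℕ => (2 : ℝ) ^ n / (2 * ((k : ℝ) - 1)) := by
  have hk1 : (0 : ℝ) < (k : ℝ) - 1 := by
    have : (2 : ℝ) ≤ k := by exact_mod_cast hk
    linarith
  rw [isEquivalent_iff_tendsto_one (Eventually.of_forall fun n => by positivity)]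
  rw [Metric.tendsto_nhds]
  intro ε hε
  -- Half of `ε` absorbs the waste `1 / N` per chain, the other half the binomial remainder.
  obtain ⟨N, hN⟩ := exists_nat_gt (2 / ε)
  have hN0' : (0 : ℝ) < N := lt_trans (by positivity) hN
  have hN0 : 0 < N := Nat.cast_pos.1 hN0'
  have hNε : 1 / (N : ℝ) < ε / 2 := by
    rw [div_lt_iff₀ hε] at hN
    rw [div_lt_iff₀ hN0']
    linarith
  have hup : Tendsto (fun n : ℕ => 4 * (N * ((k : ℝ) - 1)) * ((k : ℝ) - 1) *
      (((n.choose (n / 2) : ℕ) : ℝ) / 2 ^ n)) atTop (nhds 0) := by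
    simpa using tendsto_choose_half_div_two_pow.const_mul (4 * (N * ((k : ℝ) - 1)) * ((k : ℝ) - 1))
  have hlow : Tendsto (fun n : ℕ => ((4 * k - 2 : ℕ) : ℝ) ^ 2 / n) atTop (nhds 0) :=
    tendsto_const_div_atTop_nhds_zero_nat _
  filter_upwards [hup.eventually_lt_const (half_pos hε), hlow.eventually_lt_const hε,
    eventually_gt_atTop 0, eventually_ge_atTop (4 * k * 2 ^ (2 * k - 1) * Fintype.card W)]
    with n h1 h2 hn0 hn
  have h2n : (0 : ℝ) < 2 ^ n := by positivity
  have hl := two_pow_le_bergeNumber hk hGk hn0 hn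
  have hu := (Nat.cast_le (α := ℝ)).2
    (bergeNumber_mul_le hG (p := k - 1) (by omega) (by omega) hN0 hn0)
  push_cast [Nat.cast_pred (show 0 < k by omega)] at hu
  have hratio : ((fun n : ℕ => (bergeNumber n G : ℝ)) /
      fun n : ℕ => (2 : ℝ) ^ n / (2 * ((k : ℝ) - 1))) n =
      bergeNumber n G * (2 * ((k : ℝ) - 1)) / 2 ^ n := by
    simp only [Pi.div_apply]
    field_simp
  rw [hratio, Real.dist_eq, abs_sub_lt_iff]
  constructor
  · have h3 : (bergeNumber n G * (2 * ((k : ℝ) - 1))) / 2 ^ n ≤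
        1 + 1 / N + 4 * (N * ((k : ℝ) - 1)) * ((k : ℝ) - 1) *
          (((n.choose (n / 2) : ℕ) : ℝ) / 2 ^ n) := by
      rw [div_le_iff₀ h2n]
      refine le_of_mul_le_mul_left ?_ hN0'
      have : (N : ℝ) * ((1 + 1 / N + 4 * (N * ((k : ℝ) - 1)) * ((k : ℝ) - 1) *
          (((n.choose (n / 2) : ℕ) : ℝ) / 2 ^ n)) * 2 ^ n) = (N + 1) * 2 ^ n +
          2 * (N * ((k : ℝ) - 1) * (2 * (N * ((k : ℝ) - 1)) * (n.choose (n / 2) : ℕ))) := by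
        field_simp
        ring
      rw [this]
      linarith
    linarith
  · have h3 : 1 - ((4 * k - 2 : ℕ) : ℝ) ^ 2 / n ≤
        (bergeNumber n G * (2 * ((k : ℝ) - 1))) / 2 ^ n := by
      rw [le_div_iff₀ h2n]
      linarith
    linarith

/-! ### Edge counts of cycles, paths and stars -/

theorem card_edgeSet_cycleGraph {k : ℕ} (hk : 3 ≤ k) :
    Nat.card (SimpleGraph.cycleGraph k).edgeSet = k := by
  obtain ⟨m, rfl⟩ : ∃ m, k = m + 3 := ⟨k - 3, by omega⟩
  have h := (SimpleGraph.cycleGraph (m + 3)).sum_degrees_eq_twice_card_edges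
  simp only [SimpleGraph.cycleGraph_degree_three_le, sum_const, card_univ, Fintype.card_fin,
    smul_eq_mul] at h
  rw [Nat.card_eq_fintype_card, ← SimpleGraph.edgeFinset_card]
  omega

theorem card_edgeSet_pathGraph (k : ℕ) :
    Nat.card (SimpleGraph.pathGraph (k + 1)).edgeSet = k := by
  apply le_antisymm
  · have h : (SimpleGraph.pathGraph (k + 1)).edgeSet ⊆
        Set.range fun i : Fin k => s(i.castSucc, i.succ) := by
      intro e he
      induction e using Sym2.ind with
      | _ u v =>
      rw [SimpleGraph.mem_edgeSet, SimpleGraph.pathGraph_adj] at he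
      rcases he with h | h
      · refine ⟨⟨u, by omega⟩, ?_⟩
        rw [Sym2.eq_iff]
        exact Or.inl ⟨Fin.ext rfl, Fin.ext h⟩
      · refine ⟨⟨v, by omega⟩, ?_⟩
        rw [Sym2.eq_iff]
        exact Or.inr ⟨Fin.ext rfl, Fin.ext h⟩
    calc _ ≤ Nat.card (Set.range fun i : Fin k => s(i.castSucc, i.succ)) :=
          Nat.card_mono (Set.finite_range _) h
      _ ≤ Nat.card (Fin k) := Finite.card_range_le _
      _ = k := by simp
  -- Connectedness on `k + 1` vertices forces at least `k` edges.
  · have h := (SimpleGraph.pathGraph_connected k).card_vert_le_card_edgeSet_add_one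
    simp at h
    simpa using h

theorem card_edgeSet_starGraph (k : ℕ) :
    Nat.card (SimpleGraph.starGraph (0 : Fin (k + 1))).edgeSet = k := by
  classical
  have h := (SimpleGraph.isTree_starGraph (0 : Fin (k + 1))).card_edgeFinset
  rw [Fintype.card_fin, SimpleGraph.edgeFinset_card] at h
  rw [Nat.card_eq_fintype_card]
  omega

end BergeColoring

theorem mainTheorem4 :
    (∀ k : ℕ, 3 ≤ k →
      (fun n : ℕ => (bergeNumber n (cycleWithEdges k) : ℝ)) ~[atTop]
        fun n : ℕ => (2 : ℝ) ^ n / (2 * ((k : ℝ) - 1))) ∧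
    (∀ k : ℕ, 2 ≤ k →
      (fun n : ℕ => (bergeNumber n (pathWithEdges k) : ℝ)) ~[atTop]
        fun n : ℕ => (2 : ℝ) ^ n / (2 * ((k : ℝ) - 1))) ∧
    (∀ k : ℕ, 2 ≤ k →
      (fun n : ℕ => (bergeNumber n (starWithEdges k) : ℝ)) ~[atTop]
        fun n : ℕ => (2 : ℝ) ^ n / (2 * ((k : ℝ) - 1))) := by
  refine ⟨fun k hk => ?_, fun k hk => ?_, fun k hk => ?_⟩
  · obtain ⟨m, rfl⟩ : ∃ m, k = m + 1 := ⟨k - 1, by omega⟩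
    exact BergeColoring.bergeNumber_isEquivalent SimpleGraph.cycleGraph_connected (by omega)
      (BergeColoring.card_edgeSet_cycleGraph hk)
  · exact BergeColoring.bergeNumber_isEquivalent (SimpleGraph.pathGraph_connected k) hk
      (BergeColoring.card_edgeSet_pathGraph k)
  · exact BergeColoring.bergeNumber_isEquivalent (SimpleGraph.connected_starGraph 0) hk
      (BergeColoring.card_edgeSet_starGraph k)
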